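/- Let $\mathbb D=\{z\in\mathbb C:|z|<1\}$, $D(r)=\{z:|z|<r\}$, and let $\overline{\mathbb C}=\mathbb C\cup\{\infty\}$ be the Riemann sphere with the spherical (chordal) metric $d_S(z,w)=\frac{2|z-w|}{\sqrt{1+|z|^2}\sqrt{1+|w|^2}}$, $d_S(z,\infty)=\frac{2}{\sqrt{1+|z|^2}}$. For $w\in\mathbb D$ put $\varphi_w(z)=\frac{z+w}{1+z\overline w}$. Let $f:\mathbb D\to\overline{\mathbb C}$ be a meromorphic function, let $\gamma\subseteq\mathbb D$ be a simple curve that terminates in a point $e^{i\theta}$ of the unit circle (that is, $\gamma$ is the image of a continuous injective map $[0,1)\to\mathbb D$ with limit $e^{i\theta}$ at $1$), let $r\in(0,1)$ and $c\in\overline{\mathbb C}$. For $\rho\in[0,1)$ let $$\Delta_\rho\gamma=\bigcup_{z\in\gamma}\Big\{w\in\mathbb D:\Big|\frac{z-w}{1-z\overline w}\Big|\le\rho\Big\},$$ and for $A\subseteq\mathbb D$ let $C(f,A,e^{i\theta})$ be the set of all $w\in\overline{\mathbb C}$ for which there is a sequence $(z_n)$ in $A$ with $z_n\to e^{i\theta}$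 and $f(z_n)\to w$. Then the following conditions are equivalent: 1. $f$ is normal in $D(r)$ along $\gamma$, i.e. every sequence in the family $\{f\circ\varphi_w:w\in\gamma\}$ has a subsequence that converges, in the metric $d_S$ and uniformly on the compact subsets of $D(r)$, to a function $D(r)\to\overline{\mathbb C}$; and $\lim_{\gamma\ni z\to e^{i\theta}}f(z)=c$. 2. $C(f,\Delta_{r_1}\gamma,e^{i\theta})=\{c\}$ for all $r_1\in(0,r)$. -/

import Mathlib

open Filter Topology Set

namespace CurvilinearAngle

/-- The pseudo-hyperbolic distance on the unit disk. -/
noncomputable def dPH (z w : ℂ) : ℝ := ‖(z - w) / (1 - z * (starRingEnd ℂ) w)‖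

/-- The spherical (chordal) metric on the Riemann sphere, which is modelled as the one-point
compactification `OnePoint ℂ`. -/
noncomputable def dS : OnePoint ℂ → OnePoint ℂ → ℝ
  | OnePoint.some z, OnePoint.some w =>
      2 * ‖z - w‖ / (Real.sqrt (1 + ‖z‖ ^ 2) * Real.sqrt (1 + ‖w‖ ^ 2))
  | OnePoint.some z, OnePoint.infty => 2 / Real.sqrt (1 + ‖z‖ ^ 2)
  | OnePoint.infty, OnePoint.some w => 2 / Real.sqrt (1 + ‖w‖ ^ 2)
  | OnePoint.infty, OnePoint.infty => 0

/-- The Moebius automorphism `z ↦ (z + w) / (1 + z * conj w)` of the unit disk, for `|w| < 1`. -/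
noncomputable def phi (w z : ℂ) : ℂ := (z + w) / (1 + z * (starRingEnd ℂ) w)

/-- `f` is a meromorphic function from the open unit disk to the Riemann sphere: it is continuous
as a map to the sphere and, near every point of the disk, agrees off that point with a
complex-valued meromorphic function. So its value is `∞` exactly at the poles, the poles
are isolated, and `f` is not identically `∞`. Values of `f` outside the disk are never used. -/
def IsMeromorphicOnDisk (f : ℂ → OnePoint ℂ) : Prop :=
  ∀ a ∈ Metric.ball (0 : ℂ) 1, ContinuousAt f a ∧
    ∃ g : ℂ → ℂ, MeromorphicAt g a ∧ ∀ᶠ z in 𝓝[≠] a, f z = ((g z : ℂ) : OnePoint ℂ)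

/-- `γ : [0, 1) → 𝔻` parametrizes a simple curve in the unit disk that terminates in the
point `ζ` (of the unit circle). -/
structure IsSimpleCurveTo (γ : ℝ → ℂ) (ζ : ℂ) : Prop where
  continuousOn : ContinuousOn γ (Ico 0 1)
  injOn : InjOn γ (Ico 0 1)
  mapsTo : MapsTo γ (Ico 0 1) (Metric.ball 0 1)
  tendsto : Tendsto γ (𝓝[<] 1) (𝓝 ζ)

/-- The point set of the curve parametrized by `γ : [0, 1) → 𝔻`. -/
def trace (γ : ℝ → ℂ) : Set ℂ := γ '' Ico 0 1

/-- The closed pseudo-hyperbolic disk. -/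
def closedDiskPH (z : ℂ) (r : ℝ) : Set ℂ := {w | w ∈ Metric.ball (0 : ℂ) 1 ∧ dPH z w ≤ r}

/-- The curvilinear angle `Δ_r Γ` along the point set `Γ` of a curve. -/
def angle (r : ℝ) (Γ : Set ℂ) : Set ℂ := ⋃ z ∈ Γ, closedDiskPH z r

/-- The cluster set `C(f, A, ζ)` of `f` at `ζ` along `A`. -/
def clusterSet (f : ℂ → OnePoint ℂ) (A : Set ℂ) (ζ : ℂ) : Set (OnePoint ℂ) :=
  {w | ∃ z : ℕ → ℂ, (∀ n, z n ∈ A) ∧ Tendsto z atTop (𝓝 ζ) ∧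
    Tendsto (fun n => f (z n)) atTop (𝓝 w)}

/-- Convergence of a sequence of sphere-valued functions, uniformly on the compact subsets
of `U`, in the spherical metric. -/
def LocallyConverges (F : ℕ → ℂ → OnePoint ℂ) (g : ℂ → OnePoint ℂ) (U : Set ℂ) : Prop :=
  ∀ K ⊆ U, IsCompact K → ∀ ε > 0, ∀ᶠ n in atTop, ∀ z ∈ K, dS (F n z) (g z) < ε

/-- A family of sphere-valued functions is normal in `U` in the sense of Montel: every sequence
in it has a subsequence that converges uniformly on the compact subsets of `U`. -/
def IsNormalFamily (𝓕 : Set (ℂ → OnePoint ℂ)) (U : Set ℂ) : Prop :=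
  ∀ F : ℕ → ℂ → OnePoint ℂ, (∀ n, F n ∈ 𝓕) →
    ∃ s : ℕ → ℕ, StrictMono s ∧ ∃ g : ℂ → OnePoint ℂ, LocallyConverges (fun n => F (s n)) g U

/-- `f` is normal in the disk `D(r) = {|z| < r}` along (the point set `Γ` of) a curve. -/
def IsNormalAlong (f : ℂ → OnePoint ℂ) (Γ : Set ℂ) (r : ℝ) : Prop :=
  IsNormalFamily {h | ∃ w ∈ Γ, h = fun z => f (phi w z)} (Metric.ball 0 r)

end CurvilinearAngle

/-! Let ζ be the endpoint of the curve. For 1 ⇒ 2, let `z n` in the angle tend to ζ with `f (z n) →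
q`. Nearby points `w n` of the curve, at pseudo-hyperbolic distance at most ρ < r, also tend to ζ,
and by normality a subsequence of `f ∘ φ_{w n}` has a limit `g` on D(r). Beyond `w n` the curve
crosses every pseudo-hyperbolic circle about `w n`; pulled back by `φ_{w n}`, these crossings show
that `g` takes the value `c` on every circle |z| = s < r (`LocallyConverges.exists_norm_eq`). So
`c`-points of `g` accumulate at 0, and the identity principle
(`LocallyConverges.eq_of_frequently_eq`) gives g ≡ c. The preimages of `z n` stay in |z| ≤ ρ, hence
q = c.

For 2 ⇒ 1, compactness of the sphere turns the one-point cluster set into a limit of `f` along each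
angle, which contains the curve. For normality, let the parameters of the base points accumulate at
τ. If τ < 1, the limit function is `f ∘ φ_{γ τ}` by continuity; if τ = 1, the images of compact
subsets of D(r) tend to ζ inside an angle and the limit is `c`. -/

namespace CurvilinearAngle

/-! ### The chordal metric and the topology of the sphere -/

/-- The stereographic embedding of the Riemann sphere. -/
noncomputable def stereo : OnePoint ℂ → WithLp 2 (ℂ × ℝ)
  | OnePoint.some z => WithLp.toLp 2 ((2 / (1 + ‖z‖ ^ 2) : ℝ) • z, 2 / (1 + ‖z‖ ^ 2))
  | OnePoint.infty => 0

/-- `stereo` lands on the unit sphere about (0, 1), with ∞ at the origin, so chords have Euclidean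
length `dS`. -/
theorem dist_stereo (x y : OnePoint ℂ) : dist (stereo x) (stereo y) = dS x y := by
  have key : ∀ z w : ℂ, dist (stereo z) (stereo w) = dS z w := by
    intro z w
    have hz : (0 : ℝ) < 1 + ‖z‖ ^ 2 := by positivity
    have hw : (0 : ℝ) < 1 + ‖w‖ ^ 2 := by positivity
    have h0 : 0 ≤ dS z w := by simp only [dS]; positivity
    rw [WithLp.prod_dist_eq_of_L2, ← Real.sqrt_sq h0]
    congr 1
    change dist ((2 / (1 + ‖z‖ ^ 2) : ℝ) • z) ((2 / (1 + ‖w‖ ^ 2) : ℝ) • w) ^ 2 +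
      dist (2 / (1 + ‖z‖ ^ 2)) (2 / (1 + ‖w‖ ^ 2)) ^ 2 = _
    simp only [dS, dist_eq_norm]
    rw [div_pow, mul_pow, mul_pow, Real.sq_sqrt hz.le, Real.sq_sqrt hw.le]
    have hz' := hz.ne'
    have hw' := hw.ne'
    simp only [← Complex.normSq_eq_norm_sq, Complex.normSq_apply, Real.norm_eq_abs, sq_abs] at *
    simp only [Complex.sub_re, Complex.sub_im, Complex.smul_re, Complex.smul_im, smul_eq_mul]
    field_simp
    ring
  have key' : ∀ z : ℂ, dist (stereo z) (stereo OnePoint.infty) = dS z OnePoint.infty := by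
    intro z
    have hz : (0 : ℝ) < 1 + ‖z‖ ^ 2 := by positivity
    have h0 : 0 ≤ dS z OnePoint.infty := by simp only [dS]; positivity
    rw [WithLp.prod_dist_eq_of_L2, ← Real.sqrt_sq h0]
    congr 1
    change dist ((2 / (1 + ‖z‖ ^ 2) : ℝ) • z) 0 ^ 2 + dist (2 / (1 + ‖z‖ ^ 2)) 0 ^ 2 = _
    simp only [dS, dist_zero_right, norm_smul, Real.norm_eq_abs, mul_pow, sq_abs]
    rw [div_pow _ (√_), Real.sq_sqrt hz.le]
    field_simp
    ring
  induction x with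
  | coe z =>
    induction y with
    | coe w => exact key z w
    | infty => exact key' z
  | infty =>
    induction y with
    | coe w => rw [dist_comm, key' w]; rfl
    | infty => rw [dist_self]; rfl

theorem stereo_injective : Function.Injective stereo := by
  intro x y h
  have h0 : dS x y = 0 := by rw [← dist_stereo, h, dist_self]
  induction x with
  | coe z =>
    have hz : (0 : ℝ) < 1 + ‖z‖ ^ 2 := by positivity
    induction y with
    | coe w =>
      have hw : (0 : ℝ) < 1 + ‖w‖ ^ 2 := by positivity
      have hz' := (Real.sqrt_pos.2 hz).ne'
      have hw' := (Real.sqrt_pos.2 hw).ne'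
      simpa [dS, hz', hw', sub_eq_zero] using h0
    | infty =>
      have hz' := (Real.sqrt_pos.2 hz).ne'
      simp [dS, hz'] at h0
  | infty =>
    induction y with
    | coe w =>
      have hw : (0 : ℝ) < 1 + ‖w‖ ^ 2 := by positivity
      have hw' := (Real.sqrt_pos.2 hw).ne'
      simp [dS, hw'] at h0
    | infty => rfl

theorem continuous_stereo : Continuous stereo := by
  rw [OnePoint.continuous_iff]
  constructor
  · rw [coclosedCompact_eq_cocompact]
    refine tendsto_iff_dist_tendsto_zero.2 ?_
    simp only [dist_stereo, dS]
    refine Tendsto.const_div_atTop ?_ 2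
    refine tendsto_atTop_mono (fun z => ?_) (tendsto_norm_cocompact_atTop (E := ℂ))
    exact Real.le_sqrt_of_sq_le (by linarith)
  · have h : ∀ z : ℂ, 1 + ‖z‖ ^ 2 ≠ 0 := fun z => by positivity
    simp only [stereo]
    fun_prop (disch := exact h _)

/-- A continuous injection of a compact space into a Hausdorff one. With `dist_stereo`, it says that
`dS` induces the topology of `OnePoint ℂ`. -/
theorem isEmbedding_stereo : IsEmbedding stereo :=
  (continuous_stereo.isClosedEmbedding stereo_injective).isEmbedding

theorem locallyConverges_iff_stereo {F : ℕ → ℂ → OnePoint ℂ} {g : ℂ → OnePoint ℂ} {U : Set ℂ}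
    (hU : IsOpen U) : LocallyConverges F g U ↔
      TendstoLocallyUniformlyOn (fun n z => stereo (F n z)) (fun z => stereo (g z)) atTop U := by
  rw [tendstoLocallyUniformlyOn_iff_forall_isCompact hU]
  simp only [Metric.tendstoUniformlyOn_iff, LocallyConverges, ← dist_stereo, dist_comm]

/-- Locally uniform convergence in a uniform space follows from joint convergence. -/
theorem tendstoLocallyUniformlyOn_of_joint {Y : Type*} [UniformSpace Y] {F : ℕ → ℂ → Y} {g : ℂ → Y}
    {U : Set ℂ} (hU : IsOpen U)
    (h : ∀ x ∈ U, Tendsto (fun p : ℕ × ℂ => F p.1 p.2) (atTop ×ˢ 𝓝 x) (𝓝 (g x)))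
    (hg : ContinuousOn g U) : TendstoLocallyUniformlyOn F g atTop U := by
  rw [hU.tendstoLocallyUniformlyOn_iff_forall_tendsto]
  intro x hx
  have hgx : Tendsto (fun p : ℕ × ℂ => g p.2) (atTop ×ˢ 𝓝 x) (𝓝 (g x)) :=
    (hg.continuousAt (hU.mem_nhds hx)).tendsto.comp tendsto_snd
  exact (hgx.prodMk_nhds (h x hx)).mono_right (nhds_le_uniformity (g x))

theorem LocallyConverges.of_joint {F : ℕ → ℂ → OnePoint ℂ} {g : ℂ → OnePoint ℂ} {U : Set ℂ}
    (hU : IsOpen U) (h : ∀ x ∈ U, Tendsto (fun p : ℕ × ℂ => F p.1 p.2) (atTop ×ˢ 𝓝 x) (𝓝 (g x)))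
    (hg : ContinuousOn g U) : LocallyConverges F g U :=
  (locallyConverges_iff_stereo hU).2 <| tendstoLocallyUniformlyOn_of_joint hU
    (fun x hx => (continuous_stereo.tendsto (g x)).comp (h x hx))
    (continuous_stereo.comp_continuousOn hg)

theorem LocallyConverges.continuousOn {F : ℕ → ℂ → OnePoint ℂ} {g : ℂ → OnePoint ℂ} {U : Set ℂ}
    (hU : IsOpen U) (h : LocallyConverges F g U) (hF : ∀ n, ContinuousOn (F n) U) :
    ContinuousOn g U :=
  isEmbedding_stereo.continuousOn_iff.2 <|
    ((locallyConverges_iff_stereo hU).1 h).continuousOn <|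
      Frequently.of_forall fun n => continuous_stereo.comp_continuousOn (hF n)

/-- Converse to `LocallyConverges.of_joint`; it allows evaluation of `F n` at points that move with
`n`. -/
theorem LocallyConverges.joint {F : ℕ → ℂ → OnePoint ℂ} {g : ℂ → OnePoint ℂ} {U : Set ℂ}
    (hU : IsOpen U) (h : LocallyConverges F g U) (hF : ∀ n, ContinuousOn (F n) U) {x : ℂ}
    (hx : x ∈ U) : Tendsto (fun p : ℕ × ℂ => F p.1 p.2) (atTop ×ˢ 𝓝 x) (𝓝 (g x)) := by
  rw [isEmbedding_stereo.tendsto_nhds_iff]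
  have h1 := hU.tendstoLocallyUniformlyOn_iff_forall_tendsto.1
    ((locallyConverges_iff_stereo hU).1 h) x hx
  have hgx : Tendsto (fun p : ℕ × ℂ => stereo (g p.2)) (atTop ×ˢ 𝓝 x) (𝓝 (stereo (g x))) :=
    ((continuous_stereo.comp_continuousOn (h.continuousOn hU hF)).continuousAt
      (hU.mem_nhds hx)).tendsto.comp tendsto_snd
  exact hgx.congr_uniformity h1

/-! ### Charts of the sphere -/

/-- The standard chart of the sphere away from `∞` (with value `0` at `∞`). -/
noncomputable def toPlane (x : OnePoint ℂ) : ℂ := x.elim 0 id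

/-- The chart `z ↦ 1 / z` of the sphere away from `0`. -/
noncomputable def toPlaneInv (x : OnePoint ℂ) : ℂ := (toPlane x)⁻¹

theorem continuousAt_toPlane {x : OnePoint ℂ} (hx : x ≠ OnePoint.infty) :
    ContinuousAt toPlane x := by
  induction x with
  | coe z => exact OnePoint.continuousAt_coe.2 continuousAt_id
  | infty => exact absurd rfl hx

theorem continuousAt_toPlaneInv {x : OnePoint ℂ} (hx : x ≠ ((0 : ℂ) : OnePoint ℂ)) :
    ContinuousAt toPlaneInv x := by
  induction x with
  | coe z =>
    exact OnePoint.continuousAt_coe.2 (continuousAt_id.inv₀ fun h => hx (congrArg _ h))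
  | infty =>
    refine OnePoint.continuousAt_infty'.2 ?_
    rw [coclosedCompact_eq_cocompact]
    have : toPlaneInv OnePoint.infty = 0 := by simp [toPlaneInv, toPlane]
    rw [this]
    rw [← Metric.cobounded_eq_cocompact]
    exact tendsto_inv₀_cobounded (α := ℂ)

theorem toPlane_injOn : InjOn toPlane {OnePoint.infty}ᶜ := by
  intro x hx y hy h
  induction x with
  | coe z =>
    induction y with
    | coe w => exact congrArg _ h
    | infty => exact absurd rfl hy
  | infty => exact absurd rfl hx

theorem toPlaneInv_injOn : InjOn toPlaneInv {((0 : ℂ) : OnePoint ℂ)}ᶜ := by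
  intro x hx y hy h
  have h' : toPlane x = toPlane y := inv_injective h
  induction x with
  | coe z =>
    induction y with
    | coe w => exact congrArg _ h'
    | infty => exact absurd (congrArg _ h') hx
  | infty =>
    induction y with
    | coe w => exact absurd (congrArg _ h'.symm) hy
    | infty => rfl

/-- A chart `χ` of the sphere away from the point `p` that pulls meromorphic functions on the disk
back to analytic ones. -/
structure IsChart (χ : OnePoint ℂ → ℂ) (p : OnePoint ℂ) : Prop where
  continuousAt : ∀ x ≠ p, ContinuousAt χ x
  injOn : InjOn χ {p}ᶜ
  analyticAt : ∀ f, IsMeromorphicOnDisk f → ∀ a ∈ Metric.ball (0 : ℂ) 1, f a ≠ p →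
    AnalyticAt ℂ (fun z => χ (f z)) a

theorem isChart_toPlane : IsChart toPlane OnePoint.infty where
  continuousAt _ := continuousAt_toPlane
  injOn := toPlane_injOn
  analyticAt f hf a ha hp := by
    obtain ⟨hc, g, hg, hfg⟩ := hf a ha
    -- Meromorphic and continuous at a point implies analytic there.
    refine MeromorphicAt.analyticAt ?_ (ContinuousAt.comp (continuousAt_toPlane hp) hc)
    refine hg.congr ?_
    filter_upwards [hfg] with z hz
    rw [hz]; rfl

theorem isChart_toPlaneInv : IsChart toPlaneInv ((0 : ℂ) : OnePoint ℂ) where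
  continuousAt _ := continuousAt_toPlaneInv
  injOn := toPlaneInv_injOn
  analyticAt f hf a ha hp := by
    obtain ⟨hc, g, hg, hfg⟩ := hf a ha
    refine MeromorphicAt.analyticAt ?_ (ContinuousAt.comp (g := toPlaneInv)
      (continuousAt_toPlaneInv hp) hc)
    refine hg.inv.congr ?_
    filter_upwards [hfg] with z hz
    rw [hz]; rfl

theorem exists_isChart (c : OnePoint ℂ) : ∃ χ p, IsChart χ p ∧ c ≠ p := by
  by_cases h : c = OnePoint.infty
  · exact ⟨_, _, isChart_toPlaneInv, h ▸ OnePoint.infty_ne_coe 0⟩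
  · exact ⟨_, _, isChart_toPlane, h⟩

/-! ### Moebius automorphisms of the disk -/

open ComplexConjugate in
theorem one_add_mul_conj_ne_zero {z w : ℂ} (h : ‖z‖ * ‖w‖ < 1) : 1 + z * conj w ≠ 0 := by
  intro h0
  have h1 : z * conj w = -1 := by linear_combination h0
  have h2 := congrArg norm h1
  simp only [norm_mul, RCLike.norm_conj, norm_neg, norm_one] at h2
  exact h.ne h2

theorem norm_mul_norm_lt_one {z w : ℂ} (hz : ‖z‖ < 1) (hw : ‖w‖ ≤ 1) : ‖z‖ * ‖w‖ < 1 :=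
  (mul_le_of_le_one_right (norm_nonneg z) hw).trans_lt hz

open ComplexConjugate in
-- The sign of the last product decides whether `phi w` sends `z` inside the unit circle or onto it.
theorem norm_sq_one_add_mul_conj (z w : ℂ) :
    ‖1 + z * conj w‖ ^ 2 = ‖z + w‖ ^ 2 + (1 - ‖z‖ ^ 2) * (1 - ‖w‖ ^ 2) := by
  simp only [← Complex.normSq_eq_norm_sq, Complex.normSq_apply, Complex.add_re, Complex.add_im,
    Complex.mul_re, Complex.mul_im, Complex.conj_re, Complex.conj_im, Complex.one_re,
    Complex.one_im]
  ring

theorem norm_phi_lt_one {w z : ℂ} (hw : ‖w‖ < 1) (hz : ‖z‖ < 1) : ‖phi w z‖ < 1 := by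
  have h0 := one_add_mul_conj_ne_zero (norm_mul_norm_lt_one hz hw.le)
  rw [phi, norm_div, div_lt_one (norm_pos_iff.2 h0)]
  refine lt_of_pow_lt_pow_left₀ 2 (norm_nonneg _) ?_
  rw [norm_sq_one_add_mul_conj]
  have : 0 < (1 - ‖z‖ ^ 2) * (1 - ‖w‖ ^ 2) :=
    mul_pos (by nlinarith [norm_nonneg z]) (by nlinarith [norm_nonneg w])
  linarith

theorem norm_phi_eq_one {w z : ℂ} (hw : ‖w‖ < 1) (hz : ‖z‖ = 1) : ‖phi w z‖ = 1 := by
  have h0 := one_add_mul_conj_ne_zero (z := z) (w := w) (by rwa [hz, one_mul])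
  rw [phi, norm_div, div_eq_one_iff_eq (norm_ne_zero_iff.2 h0)]
  refine (pow_left_inj₀ (norm_nonneg _) (norm_nonneg _) two_ne_zero).1 ?_
  rw [norm_sq_one_add_mul_conj, hz]
  ring

/-- The degenerate boundary case: with `continuousAt_phi`, it makes `phi w z` tend to ζ as `w → ζ`.
-/
theorem phi_of_norm_eq_one {w z : ℂ} (hw : ‖w‖ = 1) (hz : ‖z‖ < 1) : phi w z = w := by
  have h0 := one_add_mul_conj_ne_zero (norm_mul_norm_lt_one hz hw.le)
  rw [phi, div_eq_iff h0]
  have : w * (starRingEnd ℂ) w = 1 := by rw [Complex.mul_conj, Complex.normSq_eq_norm_sq, hw]; simp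
  linear_combination -z * this

theorem phi_phi_neg {w z : ℂ} (hw : ‖w‖ < 1) (hz : ‖z‖ < 1) : phi w (phi (-w) z) = z := by
  have hw' : ‖-w‖ < 1 := by rwa [norm_neg]
  have h0 := one_add_mul_conj_ne_zero (norm_mul_norm_lt_one hz hw'.le)
  have h1 := one_add_mul_conj_ne_zero (norm_mul_norm_lt_one (norm_phi_lt_one hw' hz) hw.le)
  rw [phi, div_eq_iff h1, phi]
  field_simp
  simp only [map_neg]
  ring

theorem continuousAt_phi {w z : ℂ} (h : ‖z‖ * ‖w‖ < 1) :
    ContinuousAt (fun p : ℂ × ℂ => phi p.1 p.2) (w, z) := by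
  unfold phi
  have h0 := one_add_mul_conj_ne_zero h
  refine ContinuousAt.div (by fun_prop) ?_ h0
  exact (continuous_const.add
    (continuous_snd.mul (Complex.continuous_conj.comp continuous_fst))).continuousAt

theorem continuousAt_phi_right {w z : ℂ} (h : ‖z‖ * ‖w‖ < 1) : ContinuousAt (phi w) z :=
  ContinuousAt.comp (g := fun p : ℂ × ℂ => phi p.1 p.2) (f := fun z => (w, z))
    (continuousAt_phi h) (by fun_prop)

theorem differentiableAt_phi {w z : ℂ} (hw : ‖w‖ < 1) (hz : ‖z‖ < 1) :
    DifferentiableAt ℂ (phi w) z := by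
  unfold phi
  have h0 := one_add_mul_conj_ne_zero (norm_mul_norm_lt_one hz hw.le)
  exact DifferentiableAt.div (by fun_prop) (by fun_prop) h0

theorem dPH_eq_norm_phi (z w : ℂ) : dPH z w = ‖phi (-w) z‖ := by
  simp [dPH, phi, sub_eq_add_neg]

theorem dPH_comm (z w : ℂ) : dPH z w = dPH w z := by
  rw [dPH, dPH, norm_div, norm_div, norm_sub_rev z w, ← RCLike.norm_conj (1 - z * _)]
  simp [mul_comm]

theorem dPH_phi {w z : ℂ} (hw : ‖w‖ < 1) (hz : ‖z‖ < 1) : dPH w (phi w z) = ‖z‖ := by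
  rw [dPH_comm, dPH_eq_norm_phi]
  have := phi_phi_neg (w := -w) (z := z) (by rwa [norm_neg]) hz
  rw [neg_neg] at this
  rw [this]

/-- Pseudo-hyperbolic disks of fixed radius shrink in the Euclidean sense as their centres approach
the unit circle. -/
theorem norm_phi_sub_le {w z : ℂ} {ρ : ℝ} (hw : ‖w‖ ≤ 1) (hz : ‖z‖ ≤ ρ) (hρ : ρ < 1) :
    ‖phi w z - w‖ ≤ (1 - ‖w‖ ^ 2) / (1 - ρ) := by
  have hz1 : ‖z‖ < 1 := hz.trans_lt hρ
  have h0 := one_add_mul_conj_ne_zero (norm_mul_norm_lt_one hz1 hw)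
  have h1 : phi w z - w = z * ((1 - ‖w‖ ^ 2 : ℝ) : ℂ) / (1 + z * (starRingEnd ℂ) w) := by
    have : w * (starRingEnd ℂ) w = ((‖w‖ ^ 2 : ℝ) : ℂ) := by
      rw [Complex.mul_conj, Complex.normSq_eq_norm_sq]
    rw [phi, eq_div_iff h0, sub_mul, div_mul_cancel₀ _ h0]
    push_cast at this ⊢
    linear_combination -z * this
  have h2 : 0 ≤ 1 - ‖w‖ ^ 2 := by nlinarith [norm_nonneg w]
  have h3 : 1 - ρ ≤ ‖1 + z * (starRingEnd ℂ) w‖ := by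
    have := norm_sub_le_norm_add (1 : ℂ) (z * (starRingEnd ℂ) w)
    rw [norm_one, norm_mul, RCLike.norm_conj] at this
    have := mul_le_of_le_one_right (norm_nonneg z) hw
    linarith
  rw [h1, norm_div, norm_mul, Complex.norm_real, Real.norm_of_nonneg h2]
  exact div_le_div₀ h2 (mul_le_of_le_one_left h2 hz1.le) (by linarith) h3

/-- Points at bounded pseudo-hyperbolic distance have the same limits on the unit circle. -/
theorem tendsto_of_dPH_le {z w : ℕ → ℂ} {ζ : ℂ} {ρ : ℝ} (hρ : ρ < 1) (hζ : ‖ζ‖ = 1)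
    (hz : ∀ n, ‖z n‖ < 1) (hw : ∀ n, ‖w n‖ < 1) (h : ∀ n, dPH (w n) (z n) ≤ ρ)
    (hlim : Tendsto z atTop (𝓝 ζ)) : Tendsto w atTop (𝓝 ζ) := by
  have hd : Tendsto (fun n => (1 - ‖z n‖ ^ 2) / (1 - ρ)) atTop (𝓝 0) := by
    have := ((hlim.norm.pow 2).const_sub 1).div_const (1 - ρ)
    simpa [hζ] using this
  have h0 : Tendsto (fun n => w n - z n) atTop (𝓝 0) := by
    refine squeeze_zero_norm (fun n => ?_) hd
    have := norm_phi_sub_le (z := phi (-z n) (w n)) (hz n).le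
      ((dPH_eq_norm_phi _ _).symm.trans_le (h n)) hρ
    rwa [phi_phi_neg (hz n) (hw n)] at this
  simpa using h0.add hlim

theorem phi_mem_angle {Γ : Set ℂ} {w z : ℂ} {ρ : ℝ} (hΓ : w ∈ Γ) (hw : ‖w‖ < 1) (hz : ‖z‖ ≤ ρ)
    (hz1 : ‖z‖ < 1) : phi w z ∈ angle ρ Γ :=
  mem_biUnion hΓ ⟨mem_ball_zero_iff.2 (norm_phi_lt_one hw hz1), (dPH_phi hw hz1).trans_le hz⟩

theorem subset_angle {Γ : Set ℂ} {ρ : ℝ} (hΓ : Γ ⊆ Metric.ball 0 1) (hρ : 0 ≤ ρ) :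
    Γ ⊆ angle ρ Γ := fun z hz =>
  mem_biUnion hz ⟨hΓ hz, by simpa [dPH] using hρ⟩

/-! ### Curves terminating on the unit circle -/

theorem IsSimpleCurveTo.norm_lt_one {γ : ℝ → ℂ} {ζ : ℂ} (hγ : IsSimpleCurveTo γ ζ) {t : ℝ}
    (ht : t ∈ Ico (0 : ℝ) 1) : ‖γ t‖ < 1 :=
  mem_ball_zero_iff.1 (hγ.mapsTo ht)

theorem IsSimpleCurveTo.trace_subset {γ : ℝ → ℂ} {ζ : ℂ} (hγ : IsSimpleCurveTo γ ζ) :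
    trace γ ⊆ Metric.ball 0 1 :=
  hγ.mapsTo.image_subset

/-- The curve leaves every pseudo-hyperbolic disk centred at one of its points. -/
theorem IsSimpleCurveTo.exists_dPH_eq {γ : ℝ → ℂ} {ζ : ℂ} (hγ : IsSimpleCurveTo γ ζ)
    (hζ : ‖ζ‖ = 1) {t₀ s : ℝ} (ht₀ : t₀ ∈ Ico (0 : ℝ) 1) (hs : s ∈ Ico (0 : ℝ) 1) :
    ∃ t ∈ Ico t₀ 1, ‖phi (-γ t₀) (γ t)‖ = s := by
  have hw : ‖-γ t₀‖ < 1 := by rw [norm_neg]; exact hγ.norm_lt_one ht₀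
  -- The distance from `γ t₀` starts at 0 and tends to 1, so the intermediate value theorem yields
  -- `s`.
  have hlim : Tendsto (fun t => ‖phi (-γ t₀) (γ t)‖) (𝓝[<] 1) (𝓝 1) := by
    have h1 := ((continuousAt_phi_right (w := -γ t₀) (z := ζ) (by rwa [hζ, one_mul])).tendsto.comp
      hγ.tendsto).norm
    rwa [norm_phi_eq_one hw hζ] at h1
  obtain ⟨t₁, h₁, h₂⟩ := ((hlim.eventually_const_lt hs.2).and (Ioo_mem_nhdsLT ht₀.2)).exists
  have hc : ContinuousOn (fun t => ‖phi (-γ t₀) (γ t)‖) (Icc t₀ t₁) := by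
    intro t ht
    have ht' : t ∈ Ico (0 : ℝ) 1 := ⟨ht₀.1.trans ht.1, ht.2.trans_lt h₂.2⟩
    refine ContinuousWithinAt.norm (ContinuousAt.comp_continuousWithinAt
      (continuousAt_phi_right (norm_mul_norm_lt_one (hγ.norm_lt_one ht') hw.le)) ?_)
    exact (hγ.continuousOn t ht').mono fun x hx => ⟨ht₀.1.trans hx.1, hx.2.trans_lt h₂.2⟩
  have h0 : ‖phi (-γ t₀) (γ t₀)‖ ≤ s := by simpa [phi] using hs.1
  obtain ⟨t, ht, hts⟩ := intermediate_value_Icc h₂.1.le hc ⟨h0, h₁.le⟩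
  exact ⟨t, ⟨ht.1, ht.2.trans_lt h₂.2⟩, hts⟩

/-- Each initial arc `γ '' Icc 0 a` is compact inside the open disk, hence stays away from ζ. -/
theorem IsSimpleCurveTo.tendsto_parameter {γ : ℝ → ℂ} {ζ : ℂ} (hγ : IsSimpleCurveTo γ ζ)
    (hζ : ‖ζ‖ = 1) {t : ℕ → ℝ} (ht : ∀ n, t n ∈ Ico (0 : ℝ) 1)
    (h : Tendsto (fun n => γ (t n)) atTop (𝓝 ζ)) : Tendsto t atTop (𝓝[<] 1) := by
  refine tendsto_nhdsWithin_iff.2 ⟨tendsto_order.2 ⟨fun a ha => ?_, fun a ha => ?_⟩,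
    Eventually.of_forall fun n => (ht n).2⟩
  · have hsub : Icc 0 a ⊆ Ico (0 : ℝ) 1 := fun x hx => ⟨hx.1, hx.2.trans_lt ha⟩
    have hK : IsCompact (γ '' Icc 0 a) := isCompact_Icc.image_of_continuousOn
      (hγ.continuousOn.mono hsub)
    have hmem : ζ ∈ (γ '' Icc 0 a)ᶜ := by
      rintro ⟨x, hx, rfl⟩
      exact (hγ.norm_lt_one (hsub hx)).ne hζ
    filter_upwards [h.eventually (hK.isClosed.isOpen_compl.mem_nhds hmem)] with n hn
    by_contra! hle
    exact hn ⟨t n, ⟨(ht n).1, hle⟩, rfl⟩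
  · exact Eventually.of_forall fun n => (ht n).2.trans ha

theorem IsSimpleCurveTo.tendsto_trace {γ : ℝ → ℂ} {ζ : ℂ} (hγ : IsSimpleCurveTo γ ζ)
    {t : ℕ → ℝ} (ht : ∀ n, t n ∈ Ico (0 : ℝ) 1) (h : Tendsto t atTop (𝓝[<] 1)) :
    Tendsto (fun n => γ (t n)) atTop (𝓝[trace γ] ζ) :=
  tendsto_nhdsWithin_iff.2
    ⟨hγ.tendsto.comp h, Eventually.of_forall fun n => mem_image_of_mem γ (ht n)⟩

/-! ### The identity principle for limits of meromorphic functions -/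

variable {f g : ℂ → OnePoint ℂ} {w : ℕ → ℂ} {r : ℝ} {c : OnePoint ℂ}

theorem IsMeromorphicOnDisk.continuousAt_comp_phi (hf : IsMeromorphicOnDisk f) {a z : ℂ}
    (ha : ‖a‖ < 1) (hz : ‖z‖ < 1) :
    ContinuousAt (fun p : ℂ × ℂ => f (phi p.1 p.2)) (a, z) :=
  ContinuousAt.comp (g := f) (hf _ (mem_ball_zero_iff.2 (norm_phi_lt_one ha hz))).1
    (continuousAt_phi (norm_mul_norm_lt_one hz ha.le))

theorem IsMeromorphicOnDisk.continuousOn_comp_phi (hf : IsMeromorphicOnDisk f) {a : ℂ}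
    (ha : ‖a‖ < 1) (hr : r ≤ 1) : ContinuousOn (fun z => f (phi a z)) (Metric.ball 0 r) :=
  fun z hz => (ContinuousAt.comp (g := fun p : ℂ × ℂ => f (phi p.1 p.2)) (f := fun z => (a, z))
    (hf.continuousAt_comp_phi ha ((mem_ball_zero_iff.1 hz).trans_le hr))
    (by fun_prop)).continuousWithinAt

/-- In a chart around `c`, the limit is a locally uniform limit of holomorphic functions near `x`,
so the classical identity theorem applies. -/
theorem LocallyConverges.eventually_eq_of_frequently_eq (hf : IsMeromorphicOnDisk f)
    (hw : ∀ n, ‖w n‖ < 1) (hr : r ≤ 1)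
    (h : LocallyConverges (fun n z => f (phi (w n) z)) g (Metric.ball 0 r)) {x : ℂ}
    (hx : x ∈ Metric.ball 0 r) (hfreq : ∃ᶠ z in 𝓝[≠] x, g z = c) : ∀ᶠ z in 𝓝 x, g z = c := by
  have hF : ∀ n, ContinuousOn (fun z => f (phi (w n) z)) (Metric.ball 0 r) := fun n =>
    hf.continuousOn_comp_phi (hw n) hr
  have hgc := h.continuousOn Metric.isOpen_ball hF
  have hgx : ContinuousAt g x := hgc.continuousAt (Metric.isOpen_ball.mem_nhds hx)
  have hxc : g x = c := by
    by_contra hne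
    have hev : ∀ᶠ z in 𝓝[≠] x, g z ≠ c :=
      (hgx.eventually (isOpen_compl_singleton.mem_nhds hne)).filter_mono nhdsWithin_le_nhds
    exact hfreq hev
  obtain ⟨χ, p, hχ, hp⟩ := exists_isChart c
  have hcp : {p}ᶜ ∈ 𝓝 (g x) := isOpen_compl_singleton.mem_nhds (by rw [hxc]; exact hp)
  -- One neighbourhood of `x` on which all late functions avoid the chart's excluded point `p`.
  have hJ := (h.joint Metric.isOpen_ball hF hx).eventually hcp
  obtain ⟨pa, ha, pb, hb, hab⟩ := eventually_prod_iff.1 hJ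
  obtain ⟨δ, hδ, hV⟩ := Metric.eventually_nhds_iff_ball.1
    ((hb.and (hgx.eventually hcp)).and (Metric.isOpen_ball.mem_nhds hx))
  have hdiff : DifferentiableOn ℂ (fun z => χ (g z)) (Metric.ball x δ) := by
    refine TendstoLocallyUniformlyOn.differentiableOn (φ := atTop)
      (F := fun n z => χ (f (phi (w n) z))) ?_ ?_ Metric.isOpen_ball
    · refine tendstoLocallyUniformlyOn_of_joint Metric.isOpen_ball (fun y hy => ?_) fun y hy => ?_
      · exact (hχ.continuousAt _ (hV y hy).1.2).tendsto.comp
          (h.joint Metric.isOpen_ball hF (hV y hy).2)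
      · exact ((hχ.continuousAt _ (hV y hy).1.2).comp
          (hgc.continuousAt (Metric.isOpen_ball.mem_nhds (hV y hy).2))).continuousWithinAt
    · filter_upwards [ha] with n hn y hy
      have hy1 : ‖y‖ < 1 := (mem_ball_zero_iff.1 (hV y hy).2).trans_le hr
      exact (DifferentiableAt.comp (g := fun z => χ (f z)) y
        (hχ.analyticAt f hf _ (mem_ball_zero_iff.2 (norm_phi_lt_one (hw n) hy1))
          (hab hn (hV y hy).1.1)).differentiableAt
        (differentiableAt_phi (hw n) hy1)).differentiableWithinAt
  have han : AnalyticAt ℂ (fun z => χ (g z)) x := hdiff.analyticAt (Metric.ball_mem_nhds x hδ)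
  have hev := (han.frequently_eq_iff_eventually_eq (analyticAt_const (v := χ c))).1
    (hfreq.mono fun z hz => congrArg χ hz)
  filter_upwards [hev, hgx.eventually hcp] with z hz hzp
  exact hχ.injOn hzp hp hz

theorem LocallyConverges.eq_of_frequently_eq (hf : IsMeromorphicOnDisk f)
    (hw : ∀ n, ‖w n‖ < 1) (hr : r ≤ 1)
    (h : LocallyConverges (fun n z => f (phi (w n) z)) g (Metric.ball 0 r)) {x : ℂ}
    (hx : x ∈ Metric.ball 0 r) (hfreq : ∃ᶠ z in 𝓝[≠] x, g z = c) :
    ∀ z ∈ Metric.ball 0 r, g z = c := by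
  -- This set is open, and relatively closed by the local statement; the ball is connected.
  have key : Metric.ball 0 r ⊆ {z | ∀ᶠ y in 𝓝 z, g y = c} := by
    refine (convex_ball (0 : ℂ) r).isPreconnected.subset_of_closure_inter_subset
      isOpen_setOfPred_eventually_nhds
      ⟨x, hx, h.eventually_eq_of_frequently_eq hf hw hr hx hfreq⟩ ?_
    rintro y ⟨hy, hyr⟩
    by_contra hcon
    refine hcon (h.eventually_eq_of_frequently_eq hf hw hr hyr ?_)
    have h1 : ∃ᶠ z in 𝓝 y, z ∈ {z | ∀ᶠ y in 𝓝 z, g y = c} := mem_closure_iff_frequently.1 hy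
    rw [Filter.Frequently, eventually_nhdsWithin_iff]
    refine fun hno => h1 (hno.mono fun z hz hzc => ?_)
    by_cases hzy : z = y
    · exact hcon (hzy ▸ hzc)
    · exact hz hzy hzc.self_of_nhds
  exact fun z hz => (key hz).self_of_nhds

/-! ### Cluster sets and limits -/

theorem tendsto_of_clusterSet_eq {A : Set ℂ} {ζ : ℂ} (h : clusterSet f A ζ ⊆ {c}) :
    Tendsto f (𝓝[A] ζ) (𝓝 c) := by
  have : FirstCountableTopology (OnePoint ℂ) :=
    isEmbedding_stereo.isInducing.firstCountableTopology
  refine le_nhds_of_unique_clusterPt fun q hq => ?_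
  -- By compactness a unique cluster point is a limit; countable bases turn a cluster point `q` into
  -- a sequence witnessing it.
  have : NeBot (𝓝[A] ζ ⊓ comap f (𝓝 q)) := by
    rw [neBot_inf_comap_iff_map, inf_comm]
    exact hq
  obtain ⟨z, hz⟩ := exists_seq_tendsto (𝓝[A] ζ ⊓ comap f (𝓝 q))
  obtain ⟨hz1, hz2⟩ := tendsto_inf.1 hz
  obtain ⟨hz3, hz4⟩ := tendsto_nhdsWithin_iff.1 hz1
  obtain ⟨N, hN⟩ := eventually_atTop.1 hz4
  -- The shift by `N` puts every term in `A`, not just late ones.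
  exact h ⟨fun n => z (n + N), fun n => hN _ (Nat.le_add_left N n),
    (tendsto_add_atTop_iff_nat N).2 hz3, (tendsto_add_atTop_iff_nat N).2 (tendsto_comap_iff.1 hz2)⟩

theorem IsSimpleCurveTo.mem_clusterSet {γ : ℝ → ℂ} {ζ : ℂ} (hγ : IsSimpleCurveTo γ ζ)
    (hlim : Tendsto f (𝓝[trace γ] ζ) (𝓝 c)) : c ∈ clusterSet f (trace γ) ζ := by
  have ht : ∀ n : ℕ, 1 - 1 / ((n : ℝ) + 1) ∈ Ico (0 : ℝ) 1 := fun n => by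
    have h1 : (0 : ℝ) < n + 1 := by positivity
    have h2 : 1 / ((n : ℝ) + 1) ≤ 1 := by
      rw [div_le_one h1]; linarith [(Nat.cast_nonneg n : (0 : ℝ) ≤ n)]
    have h3 : 0 < 1 / ((n : ℝ) + 1) := by positivity
    constructor <;> linarith
  have h1 : Tendsto (fun n : ℕ => 1 - 1 / ((n : ℝ) + 1)) atTop (𝓝[<] 1) := by
    refine tendsto_nhdsWithin_iff.2 ⟨?_, Eventually.of_forall fun n => (ht n).2⟩
    simpa using (tendsto_one_div_add_atTop_nhds_zero_nat (𝕜 := ℝ)).const_sub 1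
  have h2 := hγ.tendsto_trace ht h1
  exact ⟨_, fun n => mem_image_of_mem γ (ht n), (tendsto_nhdsWithin_iff.1 h2).1, hlim.comp h2⟩

theorem clusterSet_mono {A B : Set ℂ} (h : A ⊆ B) (ζ : ℂ) : clusterSet f A ζ ⊆ clusterSet f B ζ :=
  fun _ ⟨z, hz, hz'⟩ => ⟨z, fun n => h (hz n), hz'⟩

/-- A locally uniform limit of `f ∘ φ_w`, with `w` running to the end of the curve, takes the
limit of `f` along the curve on every circle about the origin. -/
theorem LocallyConverges.exists_norm_eq {γ : ℝ → ℂ} {ζ : ℂ} (hf : IsMeromorphicOnDisk f)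
    (hγ : IsSimpleCurveTo γ ζ) (hζ : ‖ζ‖ = 1) (hlim : Tendsto f (𝓝[trace γ] ζ) (𝓝 c))
    {t : ℕ → ℝ} (ht : ∀ n, t n ∈ Ico (0 : ℝ) 1) (ht1 : Tendsto t atTop (𝓝[<] 1)) (hr : r ≤ 1)
    (h : LocallyConverges (fun n z => f (phi (γ (t n)) z)) g (Metric.ball 0 r))
    {s : ℝ} (hs : s ∈ Ico 0 r) : ∃ a, ‖a‖ = s ∧ g a = c := by
  choose t' ht' hs' using fun n => hγ.exists_dPH_eq hζ (ht n) ⟨hs.1, hs.2.trans_le hr⟩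
  have hmem : ∀ n, t' n ∈ Ico (0 : ℝ) 1 := fun n => ⟨(ht n).1.trans (ht' n).1, (ht' n).2⟩
  -- The crossings come after `t n` on the curve, so they also run to its end.
  have ht1' : Tendsto t' atTop (𝓝[<] 1) := by
    refine tendsto_nhdsWithin_iff.2 ⟨?_, Eventually.of_forall fun n => (ht' n).2⟩
    exact tendsto_of_tendsto_of_tendsto_of_le_of_le (tendsto_nhdsWithin_iff.1 ht1).1
      tendsto_const_nhds (fun n => (ht' n).1) fun n => (ht' n).2.le
  obtain ⟨a, ha, k, hk, hka⟩ := (isCompact_sphere (0 : ℂ) s).tendsto_subseq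
    (x := fun n => phi (-γ (t n)) (γ (t' n))) fun n => mem_sphere_zero_iff_norm.2 (hs' n)
  have has : ‖a‖ = s := mem_sphere_zero_iff_norm.1 ha
  refine ⟨a, has, ?_⟩
  have hF : ∀ n, ContinuousOn (fun z => f (phi (γ (t n)) z)) (Metric.ball 0 r) := fun n =>
    hf.continuousOn_comp_phi (hγ.norm_lt_one (ht n)) hr
  have h1 := (h.joint Metric.isOpen_ball hF (x := a) (mem_ball_zero_iff.2 (has ▸ hs.2))).comp
    (hk.tendsto_atTop.prodMk hka)
  have h2 := (hlim.comp (hγ.tendsto_trace hmem ht1')).comp hk.tendsto_atTop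
  refine tendsto_nhds_unique h1 (h2.congr fun n => ?_)
  simp only [Function.comp_apply]
  rw [phi_phi_neg (hγ.norm_lt_one (ht _)) (hγ.norm_lt_one (hmem _))]

theorem LocallyConverges.eq_of_tendsto_trace {γ : ℝ → ℂ} {ζ : ℂ} (hf : IsMeromorphicOnDisk f)
    (hγ : IsSimpleCurveTo γ ζ) (hζ : ‖ζ‖ = 1) (hlim : Tendsto f (𝓝[trace γ] ζ) (𝓝 c))
    {t : ℕ → ℝ} (ht : ∀ n, t n ∈ Ico (0 : ℝ) 1) (ht1 : Tendsto t atTop (𝓝[<] 1)) (hr0 : 0 < r)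
    (hr : r ≤ 1) (h : LocallyConverges (fun n z => f (phi (γ (t n)) z)) g (Metric.ball 0 r)) :
    ∀ z ∈ Metric.ball 0 r, g z = c := by
  refine h.eq_of_frequently_eq hf (fun n => hγ.norm_lt_one (ht n)) hr (Metric.mem_ball_self hr0) ?_
  rw [Filter.Frequently, eventually_nhdsWithin_iff, Metric.eventually_nhds_iff]
  rintro ⟨ε, hε, hno⟩
  have hm : 0 < min ε r := lt_min hε hr0
  -- A positive radius below both ε and `r` gives a `c`-point in the punctured neighbourhood of 0.
  obtain ⟨a, ha, hac⟩ := h.exists_norm_eq hf hγ hζ hlim ht ht1 hr (s := min ε r / 2)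
    ⟨by positivity, (half_lt_self hm).trans_le (min_le_right _ _)⟩
  refine hno (y := a) ?_ ?_ hac
  · rw [dist_zero_right, ha]
    exact (half_lt_self hm).trans_le (min_le_left _ _)
  · rintro rfl
    rw [norm_zero] at ha
    linarith

theorem clusterSet_angle_subset {γ : ℝ → ℂ} {ζ : ℂ} (hf : IsMeromorphicOnDisk f)
    (hγ : IsSimpleCurveTo γ ζ) (hζ : ‖ζ‖ = 1) (hr1 : r ≤ 1)
    (hn : IsNormalAlong f (trace γ) r) (hlim : Tendsto f (𝓝[trace γ] ζ) (𝓝 c)) {ρ : ℝ}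
    (hρ0 : 0 < ρ) (hρ : ρ < r) : clusterSet f (angle ρ (trace γ)) ζ ⊆ {c} := by
  rintro q ⟨z, hz, hzζ, hzq⟩
  have hz' : ∀ n, ∃ t ∈ Ico (0 : ℝ) 1, ‖z n‖ < 1 ∧ dPH (γ t) (z n) ≤ ρ := fun n => by
    obtain ⟨_, ⟨t, ht, rfl⟩, h1, h2⟩ := mem_iUnion₂.1 (hz n)
    exact ⟨t, ht, mem_ball_zero_iff.1 h1, h2⟩
  choose t ht hz1 hd using hz'
  have hw : ∀ n, ‖γ (t n)‖ < 1 := fun n => hγ.norm_lt_one (ht n)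
  have ht1 : Tendsto t atTop (𝓝[<] 1) := hγ.tendsto_parameter hζ ht
    (tendsto_of_dPH_le (hρ.trans_le hr1) hζ hz1 hw hd hzζ)
  obtain ⟨s, hs, g, hg⟩ := hn (fun n z => f (phi (γ (t n)) z))
    fun n => ⟨γ (t n), mem_image_of_mem γ (ht n), rfl⟩
  have hgc := hg.eq_of_tendsto_trace hf hγ hζ hlim (fun n => ht (s n))
    (ht1.comp hs.tendsto_atTop) (hρ0.trans hρ) hr1
  -- The pulled-back points accumulate at some `u` with |u| ≤ ρ < r, where the limit function is
  -- already known to be `c`.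
  obtain ⟨u, hu, k, hk, hku⟩ := (isCompact_closedBall (0 : ℂ) ρ).tendsto_subseq
    (x := fun n => phi (-γ (t (s n))) (z (s n))) fun n => mem_closedBall_zero_iff.2 <| by
      rw [← dPH_eq_norm_phi, dPH_comm]; exact hd _
  have hur : u ∈ Metric.ball (0 : ℂ) r :=
    mem_ball_zero_iff.2 ((mem_closedBall_zero_iff.1 hu).trans_lt hρ)
  have h1 := (hg.joint Metric.isOpen_ball (fun n => hf.continuousOn_comp_phi (hw (s n)) hr1)
    hur).comp (hk.tendsto_atTop.prodMk hku)
  have h2 := (hzq.comp hs.tendsto_atTop).comp hk.tendsto_atTop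
  rw [hgc u hur] at h1
  refine tendsto_nhds_unique (h2.congr fun n => ?_) h1
  simp only [Function.comp_apply]
  rw [phi_phi_neg (hw _) (hz1 _)]

theorem isNormalAlong_of_tendsto {γ : ℝ → ℂ} {ζ : ℂ} (hf : IsMeromorphicOnDisk f)
    (hγ : IsSimpleCurveTo γ ζ) (hζ : ‖ζ‖ = 1) (hr1 : r ≤ 1)
    (h : ∀ ρ, 0 < ρ → ρ < r → Tendsto f (𝓝[angle ρ (trace γ)] ζ) (𝓝 c)) :
    IsNormalAlong f (trace γ) r := by
  intro F hF
  choose w hw hFw using hF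
  choose t ht htw using hw
  obtain rfl : F = fun n z => f (phi (γ (t n)) z) := funext fun n => by rw [hFw n, htw n]
  obtain ⟨τ, hτ, s, hs, hsτ⟩ := isCompact_Icc.tendsto_subseq fun n => Ico_subset_Icc_self (ht n)
  refine ⟨s, hs, ?_⟩
  rcases hτ.2.lt_or_eq with hτ1 | rfl
  · have hτ' : τ ∈ Ico (0 : ℝ) 1 := ⟨hτ.1, hτ1⟩
    refine ⟨fun z => f (phi (γ τ) z), LocallyConverges.of_joint Metric.isOpen_ball
      (fun x hx => ?_) (hf.continuousOn_comp_phi (hγ.norm_lt_one hτ') hr1)⟩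
    have h1 : Tendsto (fun n => γ (t (s n))) atTop (𝓝 (γ τ)) := (hγ.continuousOn τ hτ').tendsto.comp
      (tendsto_nhdsWithin_iff.2 ⟨hsτ, Eventually.of_forall fun n => ht (s n)⟩)
    exact (hf.continuousAt_comp_phi (hγ.norm_lt_one hτ')
      ((mem_ball_zero_iff.1 hx).trans_le hr1)).tendsto.comp
        ((h1.comp tendsto_fst).prodMk_nhds tendsto_snd)
  · refine ⟨fun _ => c, LocallyConverges.of_joint Metric.isOpen_ball (fun x hx => ?_)
      continuousOn_const⟩
    have hxr : ‖x‖ < r := mem_ball_zero_iff.1 hx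
    -- The slack between |x| and ρ keeps the images of all points near `x` in one angle.
    obtain ⟨ρ, hxρ, hρ⟩ := exists_between hxr
    have hx1 : ‖x‖ < 1 := hxr.trans_le hr1
    have h1 : Tendsto (fun n => γ (t (s n))) atTop (𝓝 ζ) := hγ.tendsto.comp
      (tendsto_nhdsWithin_iff.2 ⟨hsτ, Eventually.of_forall fun n => (ht (s n)).2⟩)
    refine (h ρ ((norm_nonneg x).trans_lt hxρ) hρ).comp (tendsto_nhdsWithin_iff.2 ⟨?_, ?_⟩)
    · have h2 := (continuousAt_phi (norm_mul_norm_lt_one hx1 hζ.le)).tendsto.comp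
        ((h1.comp tendsto_fst).prodMk_nhds (tendsto_snd (f := atTop (α := ℕ)) (g := 𝓝 x)))
      simp only [phi_of_norm_eq_one hζ hx1] at h2
      exact h2
    · have h3 : ∀ᶠ z in 𝓝 x, ‖z‖ < ρ := continuous_norm.continuousAt.eventually_lt_const hxρ
      filter_upwards [tendsto_snd.eventually h3] with p hp
      exact phi_mem_angle (mem_image_of_mem γ (ht _)) (hγ.norm_lt_one (ht _)) hp.le
        (hp.trans (hρ.trans_le hr1))

end CurvilinearAngle

theorem theorem6p2 (f : ℂ → OnePoint ℂ) (hf : CurvilinearAngle.IsMeromorphicOnDisk f)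
    (θ : ℝ) (γ : ℝ → ℂ)
    (hγ : CurvilinearAngle.IsSimpleCurveTo γ (Complex.exp (θ * Complex.I)))
    (r : ℝ) (hr0 : 0 < r) (hr1 : r < 1) (c : OnePoint ℂ) :
    (CurvilinearAngle.IsNormalAlong f (CurvilinearAngle.trace γ) r ∧
      Tendsto f (𝓝[CurvilinearAngle.trace γ] (Complex.exp (θ * Complex.I))) (𝓝 c)) ↔
    ∀ r₁ : ℝ, 0 < r₁ → r₁ < r →
      CurvilinearAngle.clusterSet f (CurvilinearAngle.angle r₁ (CurvilinearAngle.trace γ))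
        (Complex.exp (θ * Complex.I)) = {c} := by
  have hζ : ‖Complex.exp (θ * Complex.I)‖ = 1 := Complex.norm_exp_ofReal_mul_I θ
  constructor
  · rintro ⟨hn, hlim⟩ ρ hρ0 hρ
    refine Subset.antisymm
      (CurvilinearAngle.clusterSet_angle_subset hf hγ hζ hr1.le hn hlim hρ0 hρ)
      (singleton_subset_iff.2 ?_)
    exact CurvilinearAngle.clusterSet_mono
      (CurvilinearAngle.subset_angle hγ.trace_subset hρ0.le) _ (hγ.mem_clusterSet hlim)
  · intro h
    have hT := fun ρ hρ0 hρ => CurvilinearAngle.tendsto_of_clusterSet_eq (h ρ hρ0 hρ).subset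
    exact ⟨CurvilinearAngle.isNormalAlong_of_tendsto hf hγ hζ hr1.le hT,
      (hT (r / 2) (half_pos hr0) (half_lt_self hr0)).mono_left (nhdsWithin_mono _
        (CurvilinearAngle.subset_angle hγ.trace_subset (half_pos hr0).le))⟩
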